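/- Model. There are $n$ nodes. Each node has an independent Poisson clock of rate $1$. Opening a communication channel takes a random time (latency) that is exponentially distributed with a constant parameter $\lambda>0$; all latencies and random choices are independent of each other and of the clocks, and exchanging information over an established channel takes no time. Every node belongs to at most one cluster; each cluster has a leader, which is one of its members, and every clustered node knows the leader of its cluster. The clustering is arbitrary but fixed. For constants $c, C'>0$, call a node active if it belongs to a cluster of size at least $\log^{c-1} n$. Broadcasting protocol. When the clock of an active node $v$ ticks and $v$ is not locked, $v$ starts a call and is locked until the call is completed: $v$ opens, in parallel, channels to its own leader and to two nodes chosen independently and uniformly at random; once these are established it opens, in parallel, channels to the leaders of the two chosen nodes (if these have leaders). When all these channels are established, the call is completed: if one of the (at most three) contacted leaders has the message, then the others receive it as well. Ticks of a locked node start no call. At time $0$ every node may be in an arbitrary fixed state, i.e. it may be unlocked, or it may be in the middle of a call, the remaining latencies of the channels still to be established then being independent exponential with parameter $\lambda$ (the exponential distribution is memoryless). Theorem. There is a constant $c_0$ such that for all constants $c\ge c_0$, $C'>0$ and $\lambda>0$ there are constants $T$, $\kappa>0$ and $n_0$ such that the following holds for all $n\ge n_0$. If at least $n-n/\log^{C'}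 n$ nodes are organized in clusters of size at least $\log^{c-1} n$, and at time $0$ one of the leaders of these clusters has a message, then, for every such clustering, every such leader and every state of the nodes at time $0$, with probability at least $1-n^{-\kappa}$ all the leaders of these clusters have the message by time $T$ under the broadcasting protocol above. In short: the message is broadcast to all leaders of clusters of size at least $\log^{c-1}n$ in $O(1)$ time with high probability. -/

import Mathlib

open MeasureTheory ProbabilityTheory

namespace ClusterBroadcast

/-- A clustering of the nodes `0, …, n-1`: every node belongs to at most one cluster, a cluster is
named by its leader, and a leader is a member of the cluster that it leads. `leader v = none` means
that `v` is not clustered. -/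
structure Clustering (n : ℕ) where
  leader : Fin n → Option (Fin n)
  leader_leader : ∀ v l, leader v = some l → leader l = some l

variable {n : ℕ}

/-- The number of nodes in the cluster of `l` (zero if `l` is not a leader). -/
def Clustering.size (K : Clustering n) (l : Fin n) : ℕ :=
  (Finset.univ.filter fun v => K.leader v = some l).card

/-- `l` leads a cluster of size at least `log^(c-1) n`. -/
def Clustering.BigLeader (K : Clustering n) (c : ℝ) (l : Fin n) : Prop :=
  K.leader l = some l ∧ Real.log n ^ (c - 1) ≤ (K.size l : ℝ)

/-- `v` is a member of a cluster of size at least `log^(c-1) n`. -/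
def Clustering.Active (K : Clustering n) (c : ℝ) (v : Fin n) : Prop :=
  ∃ l, K.leader v = some l ∧ K.BigLeader c l

/-- `l` is one of the (at most three) leaders contacted in a call of `v` with sampled nodes `x`:
the leader of `v`, or the leader of a sampled node. -/
def Clustering.Contacted (K : Clustering n) (v : Fin n) (x : Fin 2 → Fin n) (l : Fin n) : Prop :=
  K.leader v = some l ∨ ∃ i, K.leader (x i) = some l

/-- The channels of a call with sampled nodes `x`: channel `0` goes to the own leader, channels
`1` and `2` go to the sampled nodes `x 0` and `x 1`, and channels `3` and `4` go to the leaders of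
`x 0` and `x 1`, where these exist. -/
def Clustering.channels (K : Clustering n) (x : Fin 2 → Fin n) : Finset (Fin 5) :=
  {0, 1, 2} ∪ (if (K.leader (x 0)).isSome then {3} else ∅)
    ∪ (if (K.leader (x 1)).isSome then {4} else ∅)

/-- The time needed to open the channels in `S`, when channel `i` takes time `d i`: channels
`0, 1, 2` are opened in parallel, and, after all of them, channels `3, 4` are opened in parallel. -/
noncomputable def duration (S : Finset (Fin 5)) (d : Fin 5 → ℝ) : ℝ :=
  let a : Fin 5 → ℝ := fun i => if i ∈ S then d i else 0
  max (max (a 0) (a 1)) (a 2) + max (a 3) (a 4)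

/-- The state of the nodes at time `0`. A node `v` with `pending v = ∅` is unlocked. Otherwise `v`
is in the middle of a call with sampled nodes `samples v`, of which exactly the channels in
`pending v` have not been established yet. -/
structure InitialState (K : Clustering n) where
  samples : Fin n → Fin 2 → Fin n
  pending : Fin n → Finset (Fin 5)
  pending_subset : ∀ v, pending v ⊆ K.channels (samples v)

/-- The randomness of one node: the remaining latencies of its channels pending at time `0` and,
for each `m`, the time between its ticks number `m - 1` and `m` (the first one counted from time
`0`), the latencies and the two sampled nodes of the call started at tick `m` (these are used only
if the node is not locked then). -/
abbrev NodeRandomness (n : ℕ) : Type :=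
  (Fin 5 → ℝ) × (ℕ → ℝ × (Fin 5 → ℝ) × (Fin 2 → Fin n))

/-- The law of the randomness of one node: all components are independent, the clock is a
Poisson clock of rate `1`, the latencies are exponential with parameter `lam` and the samples are
uniform on all `n` nodes. The remaining latency of a pending channel is again exponential with
parameter `lam`, since this distribution is memoryless. -/
noncomputable def nodeLaw (lam : ℝ) (n : ℕ) : Measure (NodeRandomness n) :=
  (Measure.pi fun _ : Fin 5 => expMeasure lam).prod
    (Measure.infinitePi fun _ : ℕ =>
      (expMeasure 1).prod
        ((Measure.pi fun _ : Fin 5 => expMeasure lam).prod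
          (Measure.pi fun _ : Fin 2 => uniformOn (Set.univ : Set (Fin n)))))

/-- The law of the whole system: the nodes are independent. -/
noncomputable def law (lam : ℝ) (n : ℕ) : Measure (Fin n → NodeRandomness n) :=
  Measure.pi fun _ => nodeLaw lam n

theorem isProbabilityMeasure_law {lam : ℝ} (hlam : 0 < lam) {n : ℕ} (hn : 0 < n) :
    IsProbabilityMeasure (law lam n) := by
  have : NeZero n := ⟨hn.ne'⟩
  have h1 : IsProbabilityMeasure (expMeasure lam) := isProbabilityMeasure_expMeasure hlam
  have h2 : IsProbabilityMeasure (expMeasure 1) := isProbabilityMeasure_expMeasure one_pos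
  have h3 : IsProbabilityMeasure (uniformOn (Set.univ : Set (Fin n))) :=
    isProbabilityMeasure_uniformOn Set.finite_univ Set.univ_nonempty
  unfold law nodeLaw
  infer_instance

section Dynamics

variable (K : Clustering n) (I : InitialState K) (ω : Fin n → NodeRandomness n)

/-- The time of tick number `m` of the clock of `v`. -/
noncomputable def tickTime (v : Fin n) (m : ℕ) : ℝ :=
  ∑ i ∈ Finset.range (m + 1), ((ω v).2 i).1

/-- The nodes sampled by `v` in the call started at tick number `m`. -/
def tickSamples (v : Fin n) (m : ℕ) : Fin 2 → Fin n := ((ω v).2 m).2.2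

/-- The time at which a call started by `v` at tick number `m` is completed. -/
noncomputable def completionTime (v : Fin n) (m : ℕ) : ℝ :=
  tickTime ω v m + duration (K.channels (tickSamples ω v m)) ((ω v).2 m).2.1

/-- The time at which the call of `v` that is pending at time `0` is completed. -/
noncomputable def residual (v : Fin n) : ℝ := duration (I.pending v) (ω v).1

/-- `unlockTime v m` is the completion time of the last call that `v` started before tick number
`m`. A tick is good if the node is not locked at that time; only good ticks start a call. -/
noncomputable def unlockTime (v : Fin n) : ℕ → ℝ
  | 0 => residual K I ω v
  | m + 1 =>
    if unlockTime v m ≤ tickTime ω v m then completionTime K ω v m else unlockTime v m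

/-- `Completes K I ω v x τ`: a call of `v` with sampled nodes `x` is completed at time `τ`, that
is, at time `τ` all its channels have been established. -/
inductive Completes (v : Fin n) : (Fin 2 → Fin n) → ℝ → Prop
  | pending : (I.pending v).Nonempty → Completes v (I.samples v) (residual K I ω v)
  | tick (m : ℕ) : unlockTime K I ω v m ≤ tickTime ω v m →
      Completes v (tickSamples ω v m) (completionTime K ω v m)

/-- `Informed K I ω c s l t`: at time `t` leader `l` has the message, which is at leader `s` from
time `0` on. Only active nodes perform calls. When a call is completed and one of the contacted
leaders is informed, the other contacted leaders become informed. -/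
inductive Informed (c : ℝ) (s : Fin n) : Fin n → ℝ → Prop
  | source (t : ℝ) : 0 ≤ t → Informed c s s t
  | exchange (v : Fin n) (x : Fin 2 → Fin n) (τ : ℝ) (l l' : Fin n) (t : ℝ) :
      K.Active c v → Completes K I ω v x τ → K.Contacted v x l → K.Contacted v x l' →
      Informed c s l τ → τ ≤ t → Informed c s l' t

end Dynamics

end ClusterBroadcast

namespace ClusterBroadcast

variable {n : ℕ}

/-! ### Durations of fast calls -/

/-! The first call of each node already suffices, within the time interval `(1, 2]` cut into `R`
rounds, `R` of order `log n`. With all latencies of a node at most `1 / 8`, its pending call ends by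
time `1 / 4`, whatever the initial state, and its first call ends in a given round with probability
of order `1 / R`.

Measure sets of big clusters by their number of members. Let `A` and `Z` be such sets with mass(`Z`)
≤ mass(`A`) ≤ mass(rest). The rest then has mass of order `n`, so the probability that no fast call
leads from `A` to the rest, or none back, is exponentially small in mass(`A`) divided by `R`. Each
big cluster has at least `log^(c-1) n` members, so for `c ≥ 4` this is at most `n^(-3(|A| + |Z|))`,
which beats the number of pairs (`law_real_separatedEvent_le`).

Outside these events, let `Z` be the clusters informed during a round. No fast call leads from the
clusters informed before it to those uninformed after it, so `Z` outweighs one of the two sides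
unless no cluster is left uninformed. Hence the ratio of informed to uninformed mass doubles, and `2
^ R > n ^ 2` leaves nothing uninformed (`informed_of_forall_notMem_separatedEvent`). The union bound
covers all pairs in every round, so no independence between rounds is needed. -/

theorem duration_le_of_forall_mem {S : Finset (Fin 5)} {d : Fin 5 → ℝ} {e : ℝ}
    (he : 0 ≤ e) (hd : ∀ i, d i ≤ e) : duration S d ≤ 2 * e := by
  have h : ∀ i : Fin 5, (if i ∈ S then d i else 0) ≤ e := fun i => by
    split_ifs
    exacts [hd i, he]
  have := max_le (max_le (h 0) (h 1)) (h 2)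
  have := max_le (h 3) (h 4)
  simp only [duration]
  linarith

theorem duration_nonneg (S : Finset (Fin 5)) {d : Fin 5 → ℝ} (hd : ∀ i, 0 ≤ d i) :
    0 ≤ duration S d := by
  have h : ∀ i : Fin 5, 0 ≤ (if i ∈ S then d i else 0) := fun i => by
    split_ifs
    exacts [hd i, le_rfl]
  exact add_nonneg (le_max_of_le_right (h 2)) (le_max_of_le_right (h 4))

theorem measurable_duration (S : Finset (Fin 5)) : Measurable (duration S) := by
  have h : ∀ i : Fin 5, Measurable fun d : Fin 5 → ℝ => if i ∈ S then d i else 0 := fun i => by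
    split_ifs
    exacts [measurable_pi_apply i, measurable_const]
  exact (((h 0).max (h 1)).max (h 2)).add ((h 3).max (h 4))

/-! ### Exponential and uniform measures -/

theorem expMeasure_real_Ioc {r : ℝ} (hr : 0 < r) {a b : ℝ} (ha : 0 ≤ a) (hab : a ≤ b) :
    (expMeasure r).real (Set.Ioc a b) = Real.exp (-(r * a)) - Real.exp (-(r * b)) := by
  have := isProbabilityMeasure_expMeasure hr
  have h : Set.Ioc a b = Set.Iic b \ Set.Iic a := by
    ext x
    simp [and_comm]
  rw [h, measureReal_sdiff (Set.Iic_subset_Iic.2 hab) measurableSet_Iic,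
    ← cdf_eq_real, ← cdf_eq_real, cdf_expMeasure_eq hr, cdf_expMeasure_eq hr,
    if_pos ha, if_pos (ha.trans hab)]
  ring

/-- The density of the rate `1` clock is at least `exp (-2)` on `[0, 2]`. -/
theorem le_expMeasure_one_real_Ioc {a b : ℝ} (ha : 0 ≤ a) (hab : a ≤ b) (hb : b ≤ 2) :
    Real.exp (-2) * (b - a) ≤ (expMeasure 1).real (Set.Ioc a b) := by
  rw [expMeasure_real_Ioc one_pos ha hab, one_mul, one_mul]
  have h1 : Real.exp (-a) = Real.exp (-b) * Real.exp (b - a) := by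
    rw [← Real.exp_add]; ring_nf
  have h2 := Real.add_one_le_exp (b - a)
  have h3 : Real.exp (-2) ≤ Real.exp (-b) := Real.exp_le_exp.2 (by linarith)
  have h4 := Real.exp_pos (-b)
  nlinarith

theorem pi_uniformOn_real_pair (A B : Finset (Fin n)) :
    (Measure.pi fun _ : Fin 2 => uniformOn (Set.univ : Set (Fin n))).real
      {x | x 0 ∈ A ∧ x 1 ∈ B} = A.card / n * (B.card / n) := by
  rcases n.eq_zero_or_pos with rfl | hn
  · simp [Finset.eq_empty_of_isEmpty A]
  have : NeZero n := ⟨hn.ne'⟩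
  have : {x : Fin 2 → Fin n | x 0 ∈ A ∧ x 1 ∈ B}
      = Set.univ.pi fun i => ((if i = 0 then A else B : Finset (Fin n)) : Set (Fin n)) := by
    ext x
    simp [Set.mem_pi, Fin.forall_fin_two]
  rw [this, measureReal_def, Measure.pi_pi, Fin.prod_univ_two, ENNReal.toReal_mul]
  simp [uniformOn_univ]

/-! ### The first call of a node -/

/-- The probability that a latency is at most `1 / 8`. -/
noncomputable def fastProb (lam : ℝ) : ℝ := (expMeasure lam).real (Set.Ioc 0 (1 / 8))

theorem fastProb_pos {lam : ℝ} (hlam : 0 < lam) : 0 < fastProb lam := by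
  rw [fastProb, expMeasure_real_Ioc hlam le_rfl (by norm_num), sub_pos]
  exact Real.exp_lt_exp.2 (by linarith)

/-- Vectors of latencies that are all positive and at most `1 / 8`. -/
def fastLatencies : Set (Fin 5 → ℝ) := Set.univ.pi fun _ => Set.Ioc 0 (1 / 8)

theorem measurableSet_fastLatencies : MeasurableSet fastLatencies :=
  MeasurableSet.univ_pi fun _ => measurableSet_Ioc

theorem pi_expMeasure_real_fastLatencies {lam : ℝ} (hlam : 0 < lam) :
    (Measure.pi fun _ : Fin 5 => expMeasure lam).real fastLatencies = fastProb lam ^ 5 := by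
  have := isProbabilityMeasure_expMeasure hlam
  rw [fastLatencies, measureReal_def, Measure.pi_pi, ENNReal.toReal_prod]
  simp [fastProb, measureReal_def]

theorem duration_mem_Icc_of_mem_fastLatencies (S : Finset (Fin 5)) {d : Fin 5 → ℝ}
    (hd : d ∈ fastLatencies) : duration S d ∈ Set.Icc 0 (1 / 4) := by
  have hd' : ∀ i, d i ∈ Set.Ioc (0 : ℝ) (1 / 8) := fun i => hd i trivial
  refine ⟨duration_nonneg S fun i => (hd' i).1.le, ?_⟩
  have := duration_le_of_forall_mem (S := S) (by norm_num) fun i => (hd' i).2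
  linarith

/-- The clock increment, latencies and samples of a call with fast latencies which samples a node
of `A` and a node of `B` and which, if all five channels are opened, is completed in `(a, b]` when
the clock increment is counted from time `0`. -/
def fastCall (a b : ℝ) (A B : Finset (Fin n)) : Set (ℝ × (Fin 5 → ℝ) × (Fin 2 → Fin n)) :=
  {y | y.1 + duration Finset.univ y.2.1 ∈ Set.Ioc a b} ∩
    Set.univ ×ˢ fastLatencies ×ˢ {x | x 0 ∈ A ∧ x 1 ∈ B}

theorem measurableSet_fastCall (a b : ℝ) (A B : Finset (Fin n)) :
    MeasurableSet (fastCall a b A B) := by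
  refine MeasurableSet.inter ?_ (MeasurableSet.univ.prod
    (measurableSet_fastLatencies.prod (Set.toFinite _).measurableSet))
  exact (measurable_fst.add ((measurable_duration _).comp (measurable_fst.comp measurable_snd)))
    measurableSet_Ioc

/-- Once fast latencies and samples are fixed, the tick must fall in a window of length `b - a`. The
call lasts at most `1 / 4 ≤ a`, so this window lies in `[0, 2]`. -/
theorem le_measure_fastCall {lam : ℝ} (hlam : 0 < lam) (hn : 0 < n) {a b : ℝ} (ha : 1 / 4 ≤ a)
    (hab : a ≤ b) (hb : b ≤ 2) (A B : Finset (Fin n)) :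
    Real.exp (-2) * (b - a) * (fastProb lam ^ 5 * (A.card / n * (B.card / n))) ≤
      ((expMeasure 1).prod ((Measure.pi fun _ : Fin 5 => expMeasure lam).prod
        (Measure.pi fun _ : Fin 2 => uniformOn (Set.univ : Set (Fin n))))).real
          (fastCall a b A B) := by
  have : NeZero n := ⟨hn.ne'⟩
  have := isProbabilityMeasure_expMeasure hlam
  have := isProbabilityMeasure_expMeasure one_pos
  set ρ := (Measure.pi fun _ : Fin 5 => expMeasure lam).prod
    (Measure.pi fun _ : Fin 2 => uniformOn (Set.univ : Set (Fin n))) with hρ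
  have hs : MeasurableSet (fastLatencies ×ˢ {x : Fin 2 → Fin n | x 0 ∈ A ∧ x 1 ∈ B}) :=
    measurableSet_fastLatencies.prod (Set.toFinite _).measurableSet
  have hreal : ρ.real (fastLatencies ×ˢ {x : Fin 2 → Fin n | x 0 ∈ A ∧ x 1 ∈ B})
      = fastProb lam ^ 5 * (A.card / n * (B.card / n)) := by
    rw [hρ, measureReal_prod_prod, pi_expMeasure_real_fastLatencies hlam, pi_uniformOn_real_pair]
  have hnn : 0 ≤ Real.exp (-2) * (b - a) :=
    mul_nonneg (Real.exp_pos _).le (sub_nonneg.2 hab)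
  rw [← hreal]
  refine (ENNReal.ofReal_le_iff_le_toReal (measure_ne_top _ _)).1 ?_
  rw [Measure.prod_apply_symm (measurableSet_fastCall a b A B), ENNReal.ofReal_mul hnn,
    ofReal_measureReal, ← lintegral_indicator_const hs]
  refine lintegral_mono (Set.indicator_le fun y hy => ?_)
  obtain ⟨h0, h1⟩ := duration_mem_Icc_of_mem_fastLatencies Finset.univ hy.1
  have hsub : Set.Ioc (a - duration Finset.univ y.1) (b - duration Finset.univ y.1) ⊆
      (fun t => (t, y)) ⁻¹' fastCall a b A B := fun t ht => by
    refine ⟨⟨?_, ?_⟩, trivial, hy⟩ <;> simp only <;> linarith [ht.1, ht.2]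
  refine le_trans ?_ (measure_mono hsub)
  rw [← ofReal_measureReal]
  refine ENNReal.ofReal_le_ofReal (le_trans (le_of_eq ?_)
    (le_expMeasure_one_real_Ioc (by linarith) (by linarith) (by linarith)))
  ring

/-- The randomness of a node all of whose residual latencies are small, and whose first call is
fast, samples a node of `A` and a node of `B`, and is completed in `(a, b]`. -/
def fastPush (a b : ℝ) (A B : Finset (Fin n)) : Set (NodeRandomness n) :=
  fastLatencies ×ˢ {y | y 0 ∈ fastCall a b A B}

theorem measurableSet_fastPush (a b : ℝ) (A B : Finset (Fin n)) :
    MeasurableSet (fastPush a b A B) :=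
  measurableSet_fastLatencies.prod (measurable_pi_apply 0 (measurableSet_fastCall a b A B))

theorem isProbabilityMeasure_nodeLaw {lam : ℝ} (hlam : 0 < lam) (hn : 0 < n) :
    IsProbabilityMeasure (nodeLaw lam n) := by
  have : NeZero n := ⟨hn.ne'⟩
  have := isProbabilityMeasure_expMeasure hlam
  have := isProbabilityMeasure_expMeasure one_pos
  unfold nodeLaw
  infer_instance

/-- The tenth power counts five residual latencies and five latencies of the first call. The bound
does not involve the initial state. -/
theorem le_nodeLaw_fastPush {lam : ℝ} (hlam : 0 < lam) (hn : 0 < n) {a b : ℝ} (ha : 1 / 4 ≤ a)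
    (hab : a ≤ b) (hb : b ≤ 2) (A B : Finset (Fin n)) :
    fastProb lam ^ 10 * Real.exp (-2) * (b - a) * (A.card / n * (B.card / n)) ≤
      (nodeLaw lam n).real (fastPush a b A B) := by
  have : NeZero n := ⟨hn.ne'⟩
  have := isProbabilityMeasure_expMeasure hlam
  have := isProbabilityMeasure_expMeasure one_pos
  rw [nodeLaw, fastPush, measureReal_prod_prod, pi_expMeasure_real_fastLatencies hlam]
  have h := (measurePreserving_eval_infinitePi (fun _ : ℕ =>
      (expMeasure 1).prod ((Measure.pi fun _ : Fin 5 => expMeasure lam).prod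
        (Measure.pi fun _ : Fin 2 => uniformOn (Set.univ : Set (Fin n))))) 0).measureReal_preimage
    (measurableSet_fastCall a b A B).nullMeasurableSet
  refine le_trans (le_of_eq ?_) (mul_le_mul_of_nonneg_left
    ((le_measure_fastCall hlam hn ha hab hb A B).trans_eq h.symm)
    (pow_nonneg (fastProb_pos hlam).le 5))
  ring

/-- Nodes are independent, so the probabilities multiply, and `1 - x ≤ exp (-x)`. -/
theorem law_real_forall_notMem_fastPush_le {lam : ℝ} (hlam : 0 < lam) (hn : 0 < n) {a b : ℝ}
    (ha : 1 / 4 ≤ a) (hab : a ≤ b) (hb : b ≤ 2) (D A B : Finset (Fin n)) :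
    (law lam n).real {ω | ∀ v ∈ D, ω v ∉ fastPush a b A B} ≤
      Real.exp (-(fastProb lam ^ 10 * Real.exp (-2) * (b - a) *
        (A.card / n * (B.card / n)) * D.card)) := by
  have := isProbabilityMeasure_nodeLaw hlam hn
  have hset : {ω : Fin n → NodeRandomness n | ∀ v ∈ D, ω v ∉ fastPush a b A B}
      = Set.univ.pi fun v => if v ∈ D then (fastPush a b A B)ᶜ else Set.univ := by
    ext ω
    simp only [Set.mem_ofPred_eq, Set.mem_pi, Set.mem_univ, true_imp_iff]
    refine forall_congr' fun v => ?_
    split_ifs with hv <;> simp [hv]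
  rw [hset, law, measureReal_def, Measure.pi_pi, ENNReal.toReal_prod]
  calc ∏ v, (nodeLaw lam n (if v ∈ D then (fastPush a b A B)ᶜ else Set.univ)).toReal
      = ∏ v, if v ∈ D then 1 - (nodeLaw lam n).real (fastPush a b A B) else 1 := by
        refine Finset.prod_congr rfl fun v _ => ?_
        split_ifs
        · rw [← measureReal_def, probReal_compl_eq_one_sub (measurableSet_fastPush a b A B)]
        · simp
    _ = (1 - (nodeLaw lam n).real (fastPush a b A B)) ^ D.card := by
        rw [Finset.prod_ite_mem, Finset.univ_inter, Finset.prod_const]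
    _ ≤ Real.exp (-(fastProb lam ^ 10 * Real.exp (-2) * (b - a) *
          (A.card / n * (B.card / n)))) ^ D.card := by
        refine pow_le_pow_left₀ (sub_nonneg.2 measureReal_le_one) ?_ _
        have h1 := le_nodeLaw_fastPush hlam hn ha hab hb A B
        refine le_trans ?_ (Real.add_one_le_exp _)
        linarith
    _ = _ := by
        rw [← Real.exp_nat_mul]
        ring_nf

/-! ### Members of sets of clusters -/

/-- The nodes whose leader belongs to `U`. -/
def Clustering.members (K : Clustering n) (U : Finset (Fin n)) : Finset (Fin n) :=
  Finset.univ.filter fun v => ∃ l ∈ U, K.leader v = some l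

open Classical in
/-- The leaders of clusters of size at least `log^(c-1) n`. -/
noncomputable def Clustering.bigLeaders (K : Clustering n) (c : ℝ) : Finset (Fin n) :=
  Finset.univ.filter (K.BigLeader c)

namespace Clustering

variable (K : Clustering n) {U V W : Finset (Fin n)} {c : ℝ}

theorem mem_members {v : Fin n} : v ∈ K.members U ↔ ∃ l ∈ U, K.leader v = some l := by
  simp [members]

theorem mem_bigLeaders {l : Fin n} : l ∈ K.bigLeaders c ↔ K.BigLeader c l := by
  simp [bigLeaders]

theorem card_members (U : Finset (Fin n)) : (K.members U).card = ∑ l ∈ U, K.size l := by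
  have h : K.members U = U.biUnion fun l => Finset.univ.filter fun v => K.leader v = some l := by
    ext v
    simp [mem_members]
  rw [h, Finset.card_biUnion]
  · rfl
  · intro l _ l' _ hne
    refine Finset.disjoint_left.2 fun v hv hv' => hne ?_
    simp only [Finset.mem_filter, Finset.mem_univ, true_and] at hv hv'
    simpa using hv.symm.trans hv'

theorem card_members_le : (K.members U).card ≤ n := by
  simpa using Finset.card_le_univ (K.members U)

theorem card_members_add_card_members_sdiff (h : U ⊆ W) :
    (K.members U).card + (K.members (W \ U)).card = (K.members W).card := by
  simp only [card_members]
  rw [add_comm, Finset.sum_sdiff h]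

theorem one_le_card_members {l : Fin n} (hl : l ∈ U) (h : K.leader l = some l) :
    1 ≤ (K.members U).card :=
  Finset.card_pos.2 ⟨l, K.mem_members.2 ⟨l, hl, h⟩⟩

theorem mul_card_le_card_members (h : U ⊆ K.bigLeaders c) :
    Real.log n ^ (c - 1) * U.card ≤ ((K.members U).card : ℝ) := by
  rw [card_members, Nat.cast_sum, mul_comm, ← nsmul_eq_mul]
  exact Finset.card_nsmul_le_sum _ _ _ fun l hl => (K.mem_bigLeaders.1 (h hl)).2

theorem active_iff {v : Fin n} : K.Active c v ↔ v ∈ K.members (K.bigLeaders c) := by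
  rw [mem_members]
  constructor
  · rintro ⟨l, hv, hl⟩
    exact ⟨l, K.mem_bigLeaders.2 hl, hv⟩
  · rintro ⟨l, hl, hv⟩
    exact ⟨l, hv, K.mem_bigLeaders.1 hl⟩

theorem channels_eq_univ {x : Fin 2 → Fin n} (h : ∀ i, (K.leader (x i)).isSome) :
    K.channels x = Finset.univ := by
  rw [channels, if_pos (h 0), if_pos (h 1)]
  decide

end Clustering

theorem Informed.mono {K : Clustering n} {I : InitialState K} {ω : Fin n → NodeRandomness n}
    {c : ℝ} {s l : Fin n} {t t' : ℝ} (h : Informed K I ω c s l t) (htt' : t ≤ t') :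
    Informed K I ω c s l t' := by
  cases h with
  | source _ h0 => exact .source t' (h0.trans htt')
  | exchange v x τ l₀ _ _ ha hc hl hl' hi hτ =>
    exact .exchange v x τ l₀ l t' ha hc hl hl' hi (hτ.trans htt')

/-! ### Doubling -/

/-- If in each round the newly informed mass exceeds the informed mass or the remaining uninformed
mass, then the ratio of informed to uninformed mass at least doubles in each round. -/
theorem two_pow_mul_uninformed_le {N R : ℕ} (a v : ℕ → ℕ) (hv : v 0 ≤ N) (ha : 1 ≤ a 0)
    (h : ∀ k < R, ∃ z, a (k + 1) = a k + z ∧ v k = v (k + 1) + z ∧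
      (v (k + 1) = 0 ∨ a k < z ∨ v (k + 1) < z)) :
    ∀ k ≤ R, 2 ^ k * v k ≤ N * a k := by
  intro k
  induction k with
  | zero =>
    intro _
    nlinarith
  | succ k ih =>
    intro hk
    obtain ⟨z, h1, h2, h3⟩ := h k hk
    have ih := ih (by omega)
    -- Either nothing is left uninformed, or the informed mass doubles, or the uninformed mass
    -- halves; the other mass never moves the wrong way.
    rcases h3 with h3 | h3 | h3
    · simp [h3]
    · calc 2 ^ (k + 1) * v (k + 1) ≤ 2 * (2 ^ k * v k) := by
            rw [pow_succ', mul_assoc]; gcongr; omega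
        _ ≤ 2 * (N * a k) := by gcongr
        _ = N * (2 * a k) := by ring
        _ ≤ N * a (k + 1) := by gcongr; omega
    · calc 2 ^ (k + 1) * v (k + 1) = 2 ^ k * (2 * v (k + 1)) := by ring
        _ ≤ 2 ^ k * v k := by gcongr; omega
        _ ≤ N * a k := ih
        _ ≤ N * a (k + 1) := by gcongr; omega

/-! ### Sums over sets of leaders -/

theorem sum_powerset_pow_card (B : Finset (Fin n)) (ε : ℝ) :
    ∑ A ∈ B.powerset, ε ^ A.card = (1 + ε) ^ B.card := by
  have := Finset.sum_pow_mul_eq_add_pow ε (1 : ℝ) B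
  simpa [add_comm] using this

theorem one_add_pow_card_le {B : Finset (Fin n)} {ε : ℝ} (hε : 0 ≤ ε) (h : n * ε ≤ 1) :
    (1 + ε) ^ B.card ≤ 1 + 2 * (n * ε) := by
  calc (1 + ε) ^ B.card ≤ (1 + ε) ^ n :=
        pow_le_pow_right₀ (by linarith) (by simpa using Finset.card_le_univ B)
    _ ≤ Real.exp ε ^ n := by
        gcongr
        linarith [Real.add_one_le_exp ε]
    _ = Real.exp (n * ε) := (Real.exp_nat_mul ε n).symm
    _ ≤ 1 + 2 * (n * ε) := by
        have h0 : 0 ≤ n * ε := by positivity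
        have := Real.abs_exp_sub_one_le (x := n * ε) (by rwa [abs_of_nonneg h0])
        rw [abs_of_nonneg h0] at this
        linarith [le_abs_self (Real.exp (n * ε) - 1)]

/-- The sum factorises into binomial sums. Excluding `A = ∅` removes the term `1` from the first
factor, which makes it of order `n * ε`. -/
theorem sum_pairs_pow_card_le (B : Finset (Fin n)) {ε : ℝ} (hε : 0 ≤ ε) (h : n * ε ≤ 1) :
    ∑ p ∈ (B.powerset.erase ∅) ×ˢ B.powerset, ε ^ (p.1.card + p.2.card) ≤ 6 * (n * ε) := by
  have hprod : ∑ p ∈ (B.powerset.erase ∅) ×ˢ B.powerset, ε ^ (p.1.card + p.2.card)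
      = (∑ A ∈ B.powerset.erase ∅, ε ^ A.card) * ∑ Z ∈ B.powerset, ε ^ Z.card := by
    simp only [pow_add, Finset.sum_product, Finset.sum_mul_sum]
  rw [hprod]
  have h1 := one_add_pow_card_le (B := B) hε h
  have h2 := Finset.sum_erase_add B.powerset (fun A => ε ^ A.card) (Finset.empty_mem_powerset B)
  rw [sum_powerset_pow_card] at h2
  simp only [Finset.card_empty, pow_zero] at h2
  rw [sum_powerset_pow_card]
  have h3 : 0 ≤ n * ε := by positivity
  calc _ ≤ (2 * (n * ε)) * 3 :=
        mul_le_mul (by linarith) (by linarith) (by positivity) (by positivity)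
    _ = _ := by ring

/-! ### Spreading of the message -/

theorem exists_informed_of_mem_fastPush {K : Clustering n} {I : InitialState K}
    {ω : Fin n → NodeRandomness n} {c : ℝ} {s v l : Fin n} {U V : Finset (Fin n)} {a b : ℝ}
    (ha : 1 / 2 ≤ a) (hU : U ⊆ K.bigLeaders c)
    (hl : l ∈ U) (hv : K.leader v = some l) (hi : Informed K I ω c s l a)
    (hω : ω v ∈ fastPush a b (K.members V) (K.members (K.bigLeaders c))) :
    ∃ l' ∈ V, Informed K I ω c s l' b := by
  obtain ⟨hres, ⟨hab, -, hlat, hx0, hx1⟩⟩ := hω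
  obtain ⟨l', hl', hxl'⟩ := K.mem_members.1 hx0
  obtain ⟨l₁, -, hxl₁⟩ := K.mem_members.1 hx1
  -- Both sampled nodes are clustered, so all five channels are opened, as `fastCall` presumes.
  have hchan : K.channels (tickSamples ω v 0) = Finset.univ := by
    refine K.channels_eq_univ (Fin.forall_fin_two.2 ⟨?_, ?_⟩)
    · exact Option.isSome_iff_exists.2 ⟨_, hxl'⟩
    · exact Option.isSome_iff_exists.2 ⟨_, hxl₁⟩
  have htick : tickTime ω v 0 = ((ω v).2 0).1 := by simp [tickTime]
  have hcompl : completionTime K ω v 0 ∈ Set.Ioc a b := by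
    rw [completionTime, hchan, htick]
    exact hab
  have h1 := (duration_mem_Icc_of_mem_fastLatencies Finset.univ hlat).2
  have h2 := (duration_mem_Icc_of_mem_fastLatencies (I.pending v) hres).2
  -- The tick comes after `a - 1 / 4 ≥ 1 / 4`, when the pending call is over.
  have hgood : unlockTime K I ω v 0 ≤ tickTime ω v 0 := by
    rw [htick]
    change duration (I.pending v) (ω v).1 ≤ _
    have := hab.1
    linarith
  exact ⟨l', hl', .exchange v _ _ l l' b ⟨l, hv, K.mem_bigLeaders.1 (hU hl)⟩
    (.tick 0 hgood) (.inl hv) (.inr ⟨0, hxl'⟩) (hi.mono hcompl.1.le) hcompl.2⟩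

/-- No member of a cluster in `U` has a fast first call, completed in `(a, b]`, in which it samples
a member of a cluster in `V` and an active node. -/
def noPush (K : Clustering n) (c a b : ℝ) (U V : Finset (Fin n)) :
    Set (Fin n → NodeRandomness n) :=
  {ω | ∀ v ∈ K.members U, ω v ∉ fastPush a b (K.members V) (K.members (K.bigLeaders c))}

/-- Pairs of disjoint sets `A ≠ ∅` and `Z` of leaders of big clusters such that the clusters in `A`
have at least as many members as those in `Z`, and at most as many as the remaining ones. -/
noncomputable def separators (K : Clustering n) (c : ℝ) :
    Finset (Finset (Fin n) × Finset (Fin n)) :=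
  (((K.bigLeaders c).powerset.erase ∅) ×ˢ (K.bigLeaders c).powerset).filter fun p =>
    Disjoint p.1 p.2 ∧ (K.members p.2).card ≤ (K.members p.1).card ∧
      (K.members p.1).card ≤ (K.members (K.bigLeaders c \ (p.1 ∪ p.2))).card

/-- For some separator `(A, Z)` there is no push from `A` to the remaining clusters, or vice
versa. -/
def separatedEvent (K : Clustering n) (c a b : ℝ) : Set (Fin n → NodeRandomness n) :=
  ⋃ p ∈ separators K c, noPush K c a b p.1 (K.bigLeaders c \ (p.1 ∪ p.2)) ∪
    noPush K c a b (K.bigLeaders c \ (p.1 ∪ p.2)) p.1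

/-- The lighter of `U` and the complement of `U'` serves as `A`, with `Z = U' \ U`; the other one is
then the rest. This is why separation is allowed in both directions. -/
theorem noPush_subset_separatedEvent {K : Clustering n} {c a b : ℝ} {U U' : Finset (Fin n)}
    (hUU' : U ⊆ U') (hU' : U' ⊆ K.bigLeaders c) (hU : U ≠ ∅) (hV : K.bigLeaders c \ U' ≠ ∅)
    (h1 : (K.members (U' \ U)).card ≤ (K.members U).card)
    (h2 : (K.members (U' \ U)).card ≤ (K.members (K.bigLeaders c \ U')).card) :
    noPush K c a b U (K.bigLeaders c \ U') ⊆ separatedEvent K c a b := by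
  intro ω hω
  have e1 : U ∪ U' \ U = U' := Finset.union_sdiff_of_subset hUU'
  have e2 : K.bigLeaders c \ (K.bigLeaders c \ U' ∪ U' \ U) = U := by
    ext l
    have h3 := @hUU' l
    have h4 := @hU' l
    simp only [Finset.mem_sdiff, Finset.mem_union]
    tauto
  have hZ : U' \ U ⊆ K.bigLeaders c := Finset.sdiff_subset.trans hU'
  simp only [separatedEvent, Set.mem_iUnion, Set.mem_union]
  rcases le_total (K.members U).card (K.members (K.bigLeaders c \ U')).card with h | h
  · refine ⟨(U, U' \ U), ?_, .inl (by simpa only [e1] using hω)⟩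
    simp only [separators, Finset.mem_filter, Finset.mem_product, Finset.mem_erase,
      Finset.mem_powerset, e1]
    exact ⟨⟨⟨hU, hUU'.trans hU'⟩, hZ⟩, Finset.disjoint_sdiff, h1, h⟩
  · refine ⟨(K.bigLeaders c \ U', U' \ U), ?_, .inr (by simpa only [e2] using hω)⟩
    simp only [separators, Finset.mem_filter, Finset.mem_product, Finset.mem_erase,
      Finset.mem_powerset, e2]
    exact ⟨⟨⟨hV, Finset.sdiff_subset⟩, hZ⟩,
      Finset.sdiff_disjoint.mono_right Finset.sdiff_subset, h2, h⟩

/-- The end of round number `k` if the time interval `(1, 2]` is divided into `R` rounds. -/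
noncomputable def roundTime (R k : ℕ) : ℝ := 1 + k / R

theorem informed_of_forall_notMem_separatedEvent {K : Clustering n} {I : InitialState K}
    {ω : Fin n → NodeRandomness n} {c : ℝ} {s : Fin n} (hs : K.BigLeader c s) {R : ℕ}
    (hR : n * n < 2 ^ R)
    (hω : ∀ k < R, ω ∉ separatedEvent K c (roundTime R k) (roundTime R (k + 1)))
    {l : Fin n} (hl : K.BigLeader c l) : Informed K I ω c s l 2 := by
  classical
  have hR0 : (R : ℝ) ≠ 0 := by
    rintro h
    have := s.pos
    rw [Nat.cast_eq_zero.1 h] at hR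
    nlinarith
  set B := K.bigLeaders c with hB
  set J : ℕ → Finset (Fin n) := fun k => B.filter fun l => Informed K I ω c s l (roundTime R k)
    with hJ
  have hJB : ∀ k, J k ⊆ B := fun k => Finset.filter_subset _ _
  have hpos : ∀ k, (1 : ℝ) ≤ roundTime R k := fun k => by
    rw [roundTime]
    have : (0 : ℝ) ≤ k / R := by positivity
    linarith
  have hsJ : ∀ k, s ∈ J k := fun k =>
    Finset.mem_filter.2 ⟨K.mem_bigLeaders.2 hs, .source _ (zero_le_one.trans (hpos k))⟩
  have hmono : ∀ k, J k ⊆ J (k + 1) := fun k l hl => by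
    obtain ⟨h1, h2⟩ := Finset.mem_filter.1 hl
    refine Finset.mem_filter.2 ⟨h1, h2.mono ?_⟩
    rw [roundTime, roundTime]
    gcongr
    simp
  have key := two_pow_mul_uninformed_le (N := n) (R := R) (fun k => (K.members (J k)).card)
    (fun k => (K.members (B \ J k)).card) K.card_members_le
    (K.one_le_card_members (hsJ 0) hs.1) ?_ R le_rfl
  · have hle : n * (K.members (J R)).card ≤ n * n := Nat.mul_le_mul_left _ K.card_members_le
    have hlJ : l ∈ J R := by
      by_contra hlJ
      have h1 := K.one_le_card_members
        (Finset.mem_sdiff.2 ⟨K.mem_bigLeaders.2 hl, hlJ⟩) hl.1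
      have h2 := Nat.mul_le_mul_left (2 ^ R) h1
      simp only [← hB] at h2
      omega
    have h2 := (Finset.mem_filter.1 hlJ).2
    rwa [roundTime, div_self hR0, one_add_one_eq_two] at h2
  · intro k hk
    refine ⟨(K.members (J (k + 1) \ J k)).card,
      (K.card_members_add_card_members_sdiff (hmono k)).symm, ?_, ?_⟩
    · have h1 := K.card_members_add_card_members_sdiff (hJB k)
      have h2 := K.card_members_add_card_members_sdiff (hJB (k + 1))
      have h3 := K.card_members_add_card_members_sdiff (hmono k)
      omega
    -- Otherwise the newly informed clusters form the `Z` of a separator: a push to a cluster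
    -- uninformed after the round would have informed it.
    · by_contra! hcon
      obtain ⟨h0, h1, h2⟩ := hcon
      refine hω k hk (noPush_subset_separatedEvent (hmono k) (hJB (k + 1))
        (Finset.ne_empty_of_mem (hsJ k)) ?_ h1 h2 ?_)
      · intro he
        exact h0 (by simp only [hB, he]; simp [Clustering.members])
      · intro v hv hpush
        obtain ⟨l₀, hl₀, hvl₀⟩ := K.mem_members.1 hv
        obtain ⟨l', hl', hi⟩ := exists_informed_of_mem_fastPush
          (by linarith [hpos k]) (hJB k) hl₀ hvl₀
          (Finset.mem_filter.1 hl₀).2 hpush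
        obtain ⟨h3, h4⟩ := Finset.mem_sdiff.1 hl'
        exact h4 (Finset.mem_filter.2 ⟨h3, hi⟩)

/-! ### The union bound -/

theorem law_real_noPush_le {lam : ℝ} (hlam : 0 < lam) (K : Clustering n) {c a b : ℝ}
    (ha : 1 / 4 ≤ a) (hab : a ≤ b) (hb : b ≤ 2) (hn : 0 < n) (U V : Finset (Fin n)) :
    (law lam n).real (noPush K c a b U V) ≤
      Real.exp (-(fastProb lam ^ 10 * Real.exp (-2) * (b - a) *
        ((K.members U).card * (K.members V).card *
          ((K.members (K.bigLeaders c)).card : ℝ) / n ^ 2))) := by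
  refine (law_real_forall_notMem_fastPush_le hlam hn ha hab hb _ _ _).trans_eq ?_
  congr 2
  ring

theorem law_real_separatedEvent_le {lam : ℝ} (hlam : 0 < lam) (K : Clustering n) {c a b : ℝ}
    (ha : 1 / 4 ≤ a) (hab : a ≤ b) (hb : b ≤ 2) (hn : 0 < n)
    (hN : (n : ℝ) / 2 ≤ (K.members (K.bigLeaders c)).card)
    (hp : 3 * Real.log n ≤
      fastProb lam ^ 10 * Real.exp (-2) * (b - a) / 24 * Real.log n ^ (c - 1)) :
    (law lam n).real (separatedEvent K c a b) ≤ 12 / n ^ 2 := by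
  have := isProbabilityMeasure_law hlam hn
  have hn' : (1 : ℝ) ≤ n := by exact_mod_cast hn
  set ε : ℝ := ((n : ℝ) ^ 3)⁻¹ with hε
  have hε0 : 0 ≤ ε := by positivity
  have hnε : n * ε = 1 / (n : ℝ) ^ 2 := by
    rw [hε]
    field_simp
  set q := fastProb lam ^ 10 * Real.exp (-2) * (b - a) with hq
  have hq0 : 0 ≤ q := by
    have := fastProb_pos hlam
    have : 0 ≤ b - a := sub_nonneg.2 hab
    positivity
  have hexp : Real.exp (-(3 * Real.log n)) = ε := by
    rw [Real.exp_neg, mul_comm, Real.exp_mul, Real.exp_log (by linarith), hε]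
    norm_cast
  have hterm : ∀ p ∈ separators K c, ∀ x : ℝ,
      x = (K.members p.1).card * (K.members (K.bigLeaders c \ (p.1 ∪ p.2))).card →
      Real.exp (-(q * (x * ((K.members (K.bigLeaders c)).card : ℝ) / n ^ 2))) ≤
        ε ^ (p.1.card + p.2.card) := by
    rintro ⟨A, Z⟩ hp' x rfl
    simp only [separators, Finset.mem_filter, Finset.mem_product, Finset.mem_erase,
      Finset.mem_powerset] at hp'
    obtain ⟨⟨⟨-, hA⟩, hZ⟩, hAZ, h1, h2⟩ := hp'
    have h3 := K.card_members_add_card_members_sdiff (Finset.union_subset hA hZ)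
    have h4 : (K.members (A ∪ Z)).card = (K.members A).card + (K.members Z).card := by
      simp only [Clustering.card_members]
      exact Finset.sum_union hAZ
    have h5 := K.mul_card_le_card_members hA
    have h6 := K.mul_card_le_card_members hZ
    simp only
    rw [h4] at h3
    set N := (K.members (K.bigLeaders c)).card
    set m := (K.members (K.bigLeaders c \ (A ∪ Z))).card
    set w := (K.members A).card
    set z := (K.members Z).card
    have h3' : (w : ℝ) + z + m = N := by exact_mod_cast h3
    have h1' : (z : ℝ) ≤ w := by exact_mod_cast h1
    have h2' : (w : ℝ) ≤ m := by exact_mod_cast h2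
    -- The rest is the heaviest of three parts of total mass at least `n / 2`.
    have hm : (n : ℝ) / 6 ≤ m := by linarith
    have hw0 : (0 : ℝ) ≤ w := by positivity
    have hfrac : ((w : ℝ) + z) / 24 ≤ w * m * N / (n : ℝ) ^ 2 := by
      rw [le_div_iff₀ (by positivity)]
      have h7 : (n : ℝ) / 6 * (n / 2) ≤ m * N := by gcongr
      calc ((w : ℝ) + z) / 24 * (n : ℝ) ^ 2 ≤ (w + w) / 24 * (n : ℝ) ^ 2 := by gcongr
        _ = w * ((n : ℝ) / 6 * (n / 2)) := by ring
        _ ≤ (w : ℝ) * (m * N) := by gcongr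
        _ = _ := by ring
    rw [← hexp, ← Real.exp_nat_mul]
    refine Real.exp_le_exp.2 ?_
    have h8 : 3 * Real.log n * (A.card + Z.card) ≤ q * (w * m * N / n ^ 2) := by
      calc 3 * Real.log n * ((A.card : ℝ) + Z.card)
          ≤ q / 24 * Real.log n ^ (c - 1) * (A.card + Z.card) := by gcongr
        _ = q * ((Real.log n ^ (c - 1) * A.card + Real.log n ^ (c - 1) * Z.card) / 24) := by ring
        _ ≤ q * ((w + z) / 24) := by gcongr
        _ ≤ _ := by gcongr
    push_cast
    linarith
  calc (law lam n).real (separatedEvent K c a b)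
      ≤ ∑ p ∈ separators K c, 2 * ε ^ (p.1.card + p.2.card) := by
        refine (measureReal_biUnion_finset_le _ _).trans (Finset.sum_le_sum fun p hp' => ?_)
        refine (measureReal_union_le _ _).trans ?_
        rw [two_mul]
        exact add_le_add
          ((law_real_noPush_le hlam K ha hab hb hn _ _).trans (hterm p hp' _ rfl))
          ((law_real_noPush_le hlam K ha hab hb hn _ _).trans (hterm p hp' _ (mul_comm _ _)))
    _ ≤ ∑ p ∈ ((K.bigLeaders c).powerset.erase ∅) ×ˢ (K.bigLeaders c).powerset,
          2 * ε ^ (p.1.card + p.2.card) :=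
        Finset.sum_le_sum_of_subset_of_nonneg (Finset.filter_subset _ _)
          fun _ _ _ => by positivity
    _ ≤ 2 * (6 * (n * ε)) := by
        rw [← Finset.mul_sum]
        gcongr
        refine sum_pairs_pow_card_le _ hε0 ?_
        rw [hnε, div_le_one (by positivity)]
        exact one_le_pow₀ hn'
    _ = 12 / n ^ 2 := by
        rw [hnε]
        ring

theorem law_real_not_informed_le {lam : ℝ} (hlam : 0 < lam) {K : Clustering n}
    (I : InitialState K) {c : ℝ} {s : Fin n} (hs : K.BigLeader c s) {R : ℕ} (hR : n * n < 2 ^ R)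
    (hN : (n : ℝ) / 2 ≤ (K.members (K.bigLeaders c)).card)
    (hp : 3 * Real.log n ≤
      fastProb lam ^ 10 * Real.exp (-2) * (1 / R) / 24 * Real.log n ^ (c - 1)) :
    (law lam n).real {ω | ¬ ∀ l, K.BigLeader c l → Informed K I ω c s l 2} ≤
      R * (12 / n ^ 2) := by
  have hn : 0 < n := s.pos
  have := isProbabilityMeasure_law hlam hn
  have hsub : {ω | ¬ ∀ l, K.BigLeader c l → Informed K I ω c s l 2} ⊆
      ⋃ k ∈ Finset.range R, separatedEvent K c (roundTime R k) (roundTime R (k + 1)) := by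
    intro ω hω
    by_contra hcon
    simp only [Set.mem_iUnion, Finset.mem_range, not_exists] at hcon
    exact hω fun l hl => informed_of_forall_notMem_separatedEvent hs hR hcon hl
  refine (measureReal_mono hsub (measure_ne_top _ _)).trans ((measureReal_biUnion_finset_le _ _).trans ?_)
  refine (Finset.sum_le_card_nsmul _ _ (12 / (n : ℝ) ^ 2) fun k hk => ?_).trans_eq (by simp)
  have hkR : ((k : ℝ) + 1) ≤ R := by exact_mod_cast Finset.mem_range.1 hk
  have hR0 : (0 : ℝ) < R := by
    have : (0 : ℝ) ≤ k := by positivity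
    linarith
  have hk0 : 0 ≤ (k : ℝ) / R := by positivity
  have hk1 : ((k : ℝ) + 1) / R ≤ 1 := (div_le_one hR0).2 hkR
  have hdiff : roundTime R (k + 1) - roundTime R k = 1 / R := by
    simp only [roundTime]
    push_cast
    ring
  have hstep : (0 : ℝ) ≤ 1 / R := by positivity
  refine law_real_separatedEvent_le hlam K ?_ (by linarith) ?_ hn hN (by rwa [hdiff])
  · simp only [roundTime]
    linarith
  · simp only [roundTime]
    push_cast
    linarith

/-! ### Asymptotics -/

theorem cast_two_mul_natLog_add_one_le (hn : 1 ≤ Real.log n) :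
    ((2 * (Nat.log 2 n + 1) : ℕ) : ℝ) ≤ 5 * Real.log n := by
  have h1 : (Nat.log 2 n : ℝ) ≤ Real.log n / Real.log 2 := by
    simpa [Real.logb] using Real.natLog_le_logb n 2
  have h2 : Real.log n / Real.log 2 ≤ 3 / 2 * Real.log n := by
    rw [div_le_iff₀ (Real.log_pos one_lt_two)]
    nlinarith [Real.log_two_gt_d9]
  push_cast
  linarith

theorem mul_self_lt_two_pow (n : ℕ) : n * n < 2 ^ (2 * (Nat.log 2 n + 1)) := by
  have h := Nat.lt_pow_succ_log_self one_lt_two n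
  rw [two_mul, pow_add]
  exact Nat.mul_self_lt_mul_self h

/-- Of the three logarithms in `log^3 n`, one pays for the round length, one for the left side, and
one absorbs the constant `360 = 3 * 5 * 24`. -/
theorem three_mul_log_le {R : ℕ} {q c : ℝ} (hq : 0 < q) (hc : 4 ≤ c) (hn : 1 ≤ Real.log n)
    (hqn : 360 / q ≤ Real.log n) (hR0 : 0 < R) (hR : (R : ℝ) ≤ 5 * Real.log n) :
    3 * Real.log n ≤ q * (1 / R) / 24 * Real.log n ^ (c - 1) := by
  have h1 : Real.log n ^ 3 ≤ Real.log n ^ (c - 1) := by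
    rw [← Real.rpow_natCast]
    exact Real.rpow_le_rpow_of_exponent_le hn (by push_cast; linarith)
  have hL : 0 < Real.log n := by linarith
  have hR0' : (0 : ℝ) < R := by exact_mod_cast hR0
  rw [div_le_iff₀ hq] at hqn
  calc 3 * Real.log n = 360 * Real.log n / 120 := by ring
    _ ≤ Real.log n * q * Real.log n / 120 := by gcongr
    _ = q * (1 / (5 * Real.log n)) / 24 * Real.log n ^ 3 := by
        field_simp
        norm_num
    _ ≤ _ := by gcongr

theorem eventually_large (M C' : ℝ) (hC' : 0 < C') : ∀ᶠ n : ℕ in Filter.atTop,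
    1 ≤ Real.log n ∧ M ≤ Real.log n ∧ 2 ≤ Real.log n ^ C' ∧ 60 * Real.log n ≤ n := by
  have h : Filter.Tendsto (fun n : ℕ => Real.log n) Filter.atTop Filter.atTop :=
    Real.tendsto_log_atTop.comp tendsto_natCast_atTop_atTop
  have h2 := tendsto_natCast_atTop_atTop.eventually
    (Real.isLittleO_log_id_atTop.bound (show (0 : ℝ) < 1 / 60 by norm_num))
  filter_upwards [h.eventually_ge_atTop 1, h.eventually_ge_atTop M,
    ((tendsto_rpow_atTop hC').comp h).eventually_ge_atTop 2, h2] with n h1 hM hC h60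
  refine ⟨h1, hM, hC, ?_⟩
  rw [Real.norm_of_nonneg (by linarith), id, Real.norm_of_nonneg n.cast_nonneg] at h60
  linarith

end ClusterBroadcast

theorem theorem5 :
    ∃ c₀ : ℝ, ∀ c : ℝ, c₀ ≤ c → ∀ C' : ℝ, 0 < C' → ∀ lam : ℝ, 0 < lam →
      ∃ T κ : ℝ, 0 < κ ∧ ∃ n₀ : ℕ, ∀ n : ℕ, n₀ ≤ n →
        ∀ (K : ClusterBroadcast.Clustering n) (I : ClusterBroadcast.InitialState K) (s : Fin n),
          (n : ℝ) - n / Real.log n ^ C' ≤ ({v : Fin n | K.Active c v}.ncard : ℝ) →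
          K.BigLeader c s →
          (ClusterBroadcast.law lam n).real
              {ω | ¬ ∀ l : Fin n, K.BigLeader c l → ClusterBroadcast.Informed K I ω c s l T}
            ≤ (n : ℝ) ^ (-κ) := by
  refine ⟨4, fun c hc C' hC' lam hlam => ⟨2, 1, one_pos, ?_⟩⟩
  have hq : 0 < ClusterBroadcast.fastProb lam ^ 10 * Real.exp (-2) :=
    mul_pos (pow_pos (ClusterBroadcast.fastProb_pos hlam) 10) (Real.exp_pos _)
  obtain ⟨n₀, hn₀⟩ := Filter.eventually_atTop.1 (ClusterBroadcast.eventually_large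
    (360 / (ClusterBroadcast.fastProb lam ^ 10 * Real.exp (-2))) C' hC')
  refine ⟨n₀, fun n hn K I s hN hs => ?_⟩
  obtain ⟨h1, hM, h2, h60⟩ := hn₀ n hn
  have hnpos : (0 : ℝ) < n := Nat.cast_pos.2 s.pos
  have hR := ClusterBroadcast.cast_two_mul_natLog_add_one_le h1
  have hact : {v : Fin n | K.Active c v} = K.members (K.bigLeaders c) := by
    ext v
    exact K.active_iff
  rw [hact, Set.ncard_coe_finset] at hN
  have hhalf : (n : ℝ) / Real.log n ^ C' ≤ n / 2 := by gcongr
  refine (ClusterBroadcast.law_real_not_informed_le hlam I hs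
    (ClusterBroadcast.mul_self_lt_two_pow n) (by linarith)
    (ClusterBroadcast.three_mul_log_le hq hc h1 hM (by omega) hR)).trans ?_
  -- The total is at most `5 log n * 12 / n ^ 2`, and `60 log n ≤ n`.
  rw [Real.rpow_neg_one, inv_eq_one_div, mul_div_assoc', div_le_div_iff₀ (by positivity) hnpos]
  nlinarith
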